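/- Let $A$ be a complete Heyting algebra and let $K\subseteq A$ be a well-founded basis: $K$ contains no infinite strictly descending sequence $k_0>k_1>\cdots$, and $a=\bigvee\{k\in K\mid k\le a\}$ for every $a\in A$. Let $\mathrm{Sh}(A)$ be the category of sheaves of sets on $A$ for the topology in which a sieve $B$ on $a$ covers iff $\bigvee B=a$. Put $p(a)=\bigvee\{k\in K\mid k<a\}$, let $\blacktriangleright X$ be the sheaf associated to the presheaf $X\circ p$, and let $\mathrm{next}_X\colon X\to\blacktriangleright X$ be the composite of the restriction map $X\to X\circ p$, $x\in X(a)\mapsto x|_{p(a)}$, with the unit of sheafification. The functor $\blacktriangleright$ preserves finite products. For a category $\mathcal C$ enriched in $\mathrm{Sh}(A)$ (with its cartesian product), let $\blacktriangleright\mathcal C$ be the enriched category with the same objects and with hom-objects $\blacktriangleright\,\mathcal C(X,Y)$; $\mathrm{next}$ gives an enriched functor $\mathcal C\to\blacktriangleright\mathcal C$ that is the identity on objects. An enriched functor $F\colon\mathcal C\to\mathcal C$ is locally contractive if $F=G\circ\mathrm{next}$ for some enriched functor $G\colon\blacktriangleright\mathcal C\to\mathcal C$. The externalisation of $\mathcal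 C$ is the ordinary category with the same objects whose morphisms $X\to Y$ are the morphisms $1\to\mathcal C(X,Y)$ in $\mathrm{Sh}(A)$. Theorem. If $\mathcal C$ is a $\mathrm{Sh}(A)$-enriched category whose externalisation has all small limits (in the ordinary, not the enriched, sense), then $\mathcal C$ is contractively complete: for every locally contractive enriched functor $F\colon\mathcal C\to\mathcal C$ there is an object $X$ of $\mathcal C$ such that $FX\cong X$ in the externalisation of $\mathcal C$. -/

import Mathlib

open CategoryTheory Limits MonoidalCategory CartesianMonoidalCategory Opposite

universe v u

namespace GuardedRec

/-- The canonical Grothendieck topology on a complete Heyting algebra: a sieve `S` on `a` covers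
when the join of the elements of `S` is `a`. -/
def canonicalTopology (A : Type v) [Order.Frame A] : GrothendieckTopology A where
  sieves a := {S | sSup {b | ∃ f : b ⟶ a, S f} = a}
  top_mem' a := le_antisymm (sSup_le fun _ h => h.elim fun f _ => f.le)
    (le_sSup (show ∃ f : a ⟶ a, (⊤ : Sieve a) f from ⟨𝟙 a, trivial⟩))
  pullback_stable' a b S f hS := by
    have hS' : sSup {c | ∃ g : c ⟶ a, S g} = a := hS
    refine le_antisymm (sSup_le fun _ h => h.elim fun g _ => g.le) ?_
    calc b ≤ b ⊓ sSup {c | ∃ g : c ⟶ a, S g} := le_inf le_rfl (f.le.trans hS'.ge)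
      _ = ⨆ c ∈ {c | ∃ g : c ⟶ a, S g}, b ⊓ c := inf_sSup_eq
      _ ≤ _ := by
        refine iSup₂_le ?_
        rintro c ⟨g, hg⟩
        refine le_sSup (show ∃ h : b ⊓ c ⟶ b, S (h ≫ f) from ⟨homOfLE inf_le_left, ?_⟩)
        exact S.downward_closed hg (homOfLE (inf_le_right : b ⊓ c ≤ c))
  transitive' a S hS R hR := by
    have hS' : sSup {c | ∃ g : c ⟶ a, S g} = a := hS
    refine le_antisymm (sSup_le fun _ h => h.elim fun g _ => g.le) (hS'.ge.trans (sSup_le ?_))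
    rintro b ⟨f, hf⟩
    have h : sSup {c | ∃ g : c ⟶ b, (R.pullback f) g} = b := hR hf
    refine h.ge.trans (sSup_le ?_)
    rintro c ⟨g, hg⟩
    exact le_sSup (show ∃ k : c ⟶ a, R k from ⟨g ≫ f, hg⟩)

/-- The topos `Sh(A)` of (`Type v`-valued) sheaves on a complete Heyting algebra `A`. -/
abbrev Sh (A : Type v) [Order.Frame A] : Type (v + 1) := Sheaf (canonicalTopology A) (Type v)

variable {A : Type v} [Order.Frame A]

/-- `K ⊆ A` is a well-founded basis: it has no infinite strictly descending sequence, and every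
element of `A` is the least upper bound of the members of `K` below it. -/
structure IsWellFoundedBasis (K : Set A) : Prop where
  wellFounded : ¬ ∃ s : ℕ → A, (∀ n, s n ∈ K) ∧ ∀ n, s (n + 1) < s n
  isLUB : ∀ a : A, IsLUB {k | k ∈ K ∧ k ≤ a} a

/-- The predecessor map `p(a) = ⋁ {k ∈ K | k < a}`. -/
def pred (K : Set A) (a : A) : A := sSup {k | k ∈ K ∧ k < a}

theorem pred_mono (K : Set A) : Monotone (pred K) :=
  fun _ _ h => sSup_le_sSup fun _ hk => ⟨hk.1, hk.2.trans_le h⟩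

theorem pred_le (K : Set A) (a : A) : pred K a ≤ a := sSup_le fun _ hk => hk.2.le

/-- Precomposition `p^* : X ↦ X ∘ p` with the predecessor map, on presheaves. -/
abbrev predPullback (K : Set A) : (Aᵒᵖ ⥤ Type v) ⥤ (Aᵒᵖ ⥤ Type v) :=
  (Functor.whiskeringLeft _ _ (Type v)).obj (pred_mono K).functor.op

/-- The natural transformation `X ⟶ p^* X` of presheaves, which restricts `x ∈ X(a)` to `p(a)`. -/
def nextPre (K : Set A) : 𝟭 (Aᵒᵖ ⥤ Type v) ⟶ predPullback K where
  app X :=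
    { app := fun a => X.map (homOfLE (pred_le K a.unop)).op
      naturality := fun a b f => by
        dsimp
        rw [← X.map_comp, ← X.map_comp]
        rfl }
  naturality X Y f := by
    ext a : 2
    exact (f.naturality (homOfLE (pred_le K a.unop)).op).symm

/-- The functor `▶ : Sh(A) ⥤ Sh(A)`: the associated sheaf of `p^* X`. -/
noncomputable def later (K : Set A) : Sh A ⥤ Sh A :=
  sheafToPresheaf _ _ ⋙ predPullback K ⋙ presheafToSheaf (canonicalTopology A) (Type v)

/-- `next : X ⟶ ▶ X`, the composite of `nextPre` and the unit of sheafification. -/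
noncomputable def next (K : Set A) : 𝟭 (Sh A) ⟶ later K where
  app X := ⟨(nextPre K).app X.obj ≫ toSheafify (canonicalTopology A) _⟩
  naturality X Y f := by
    apply ObjectProperty.hom_ext
    have h₁ := (nextPre K).naturality f.hom
    have h₂ := toSheafify_naturality (canonicalTopology A) ((predPullback K).map f.hom)
    change f.hom ≫ (nextPre K).app Y.obj ≫ toSheafify (canonicalTopology A) _ =
      ((nextPre K).app X.obj ≫ toSheafify (canonicalTopology A) _) ≫
        sheafifyMap (canonicalTopology A) ((predPullback K).map f.hom)
    rw [Category.assoc, ← h₂, ← Category.assoc, ← Category.assoc, ← h₁]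
    rfl

instance later_preservesFiniteProducts (K : Set A) : PreservesFiniteProducts (later K) := by
  unfold later
  infer_instance

/-- `▶` preserves finite products, hence is a monoidal functor for the cartesian structure. -/
noncomputable instance laterMonoidal (K : Set A) : (later K).Monoidal :=
  Functor.Monoidal.ofChosenFiniteProducts (later K)

/-- The enriched category `▶C`: same objects as `C`, and `▶C(X, Y)` is `▶(C(X, Y))`. -/
abbrev LaterCat (K : Set A) (C : Type u) [EnrichedCategory (Sh A) C] : Type u :=
  TransportEnrichment (later K) C

/-- A natural transformation from the identity to a monoidal functor between cartesian monoidal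
categories respects binary products. -/
theorem next_tensor {V : Type*} [Category V] [CartesianMonoidalCategory V] {L : V ⥤ V}
    [L.Monoidal] (t : 𝟭 V ⟶ L) (P Q : V) :
    t.app (P ⊗ Q) = (t.app P ⊗ₘ t.app Q) ≫ Functor.LaxMonoidal.μ L P Q := by
  rw [← cancel_mono (Functor.Monoidal.μIso L P Q).inv]
  have hf := t.naturality (fst P Q)
  have hs := t.naturality (snd P Q)
  apply CartesianMonoidalCategory.hom_ext
  · simpa using hf.symm
  · simpa using hs.symm

/-- The enriched functor `next : C ⥤ ▶C`: the identity on objects, and `next` on hom-sheaves. -/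
noncomputable def nextFunctor (K : Set A) (C : Type u) [EnrichedCategory (Sh A) C] :
    EnrichedFunctor (Sh A) C (LaterCat K C) where
  obj X := X
  map X Y := (next K).app (EnrichedCategory.Hom (V := Sh A) X Y)
  map_id X := by
    change eId (Sh A) X ≫ (next K).app _ =
      Functor.LaxMonoidal.ε (later K) ≫ (later K).map (eId (Sh A) X)
    have h := (next K).naturality (eId (Sh A) X)
    have h₁ : (next K).app (𝟙_ (Sh A)) = Functor.LaxMonoidal.ε (later K) := by
      rw [← cancel_mono (Functor.Monoidal.εIso (later K)).inv]
      exact toUnit_unique _ _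
    rw [← h₁]
    exact h
  map_comp X Y Z := by
    change eComp (Sh A) X Y Z ≫ (next K).app _ = ((next K).app _ ⊗ₘ (next K).app _) ≫
      Functor.LaxMonoidal.μ (later K) _ _ ≫ (later K).map (eComp (Sh A) X Y Z)
    have h := (next K).naturality (eComp (Sh A) X Y Z)
    have h₁ (P Q : Sh A) : (next K).app (P ⊗ Q) =
        ((next K).app P ⊗ₘ (next K).app Q) ≫ Functor.LaxMonoidal.μ (later K) P Q :=
      @next_tensor (Sh A) _ _ (later K) (laterMonoidal K) (next K) P Q
    rw [← Category.assoc, ← h₁]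
    exact h

/-- An enriched functor is locally contractive if it factors through `next : C ⥤ ▶C` as an
enriched functor. -/
def LocallyContractive (K : Set A) {C D : Type u} [EnrichedCategory (Sh A) C]
    [EnrichedCategory (Sh A) D] (F : EnrichedFunctor (Sh A) C D) : Prop :=
  ∃ G : EnrichedFunctor (Sh A) (LaterCat K C) D, F = (nextFunctor K C).comp (Sh A) G

/-- Every locally contractive enriched endofunctor `F` of `C` has a fixed point: an object `X`
with `F X ≅ X` in the externalisation of `C`. -/
def ContractivelyComplete (K : Set A) (C : Type u) [EnrichedCategory (Sh A) C] : Prop :=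
  ∀ F : EnrichedFunctor (Sh A) C C, LocallyContractive K F →
    ∃ X : C, Nonempty (ForgetEnrichment.of (Sh A) (F.obj X) ≅ ForgetEnrichment.of (Sh A) X)

end GuardedRec

namespace GuardedRec

/-! By Lambek's lemma it suffices to find an initial algebra of the ordinary endofunctor underlying
`F`. Algebras inherit limits from the externalisation, and with wide equalizers a weakly initial
object yields an initial one, so only the existence of morphisms matters.

A weakly initial algebra is reached by approximation. A `PartialInitial` is an algebra with, for
every algebra `Y`, an algebra morphism to `Y` defined only over a stage `c` of `A`. Since `F` acts
on hom-sheaves through `▶`, applying it raises the stage to `laterLevel K c` (`succ`). Chains have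
colimits, given by limits of algebras and joins of stages (`chainCoconeIsColimit`). By Löb induction
(`eq_top_of_laterLevel_le`) the stage grows strictly until it is `⊤`, so an iteration longer than
the cardinality of `A` reaches `⊤`. There the partial morphisms give global sections, that is,
actual morphisms. -/

variable {A : Type v} [Order.Frame A]

/-! ### Subterminal sheaves and gluing along joins -/

theorem iSup_isSheafFor (S : Sh A) {ι : Type*} (c : ι → A) :
    (Presieve.ofArrows c fun i => homOfLE (le_iSup c i)).IsSheafFor S.obj := by
  refine ((isSheaf_iff_isSheaf_of_type _ _).1 S.property).isSheafFor _ ?_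
  refine le_antisymm (sSup_le fun _ h => h.elim fun f _ => f.le) (iSup_le fun i => le_sSup ?_)
  exact ⟨homOfLE (le_iSup c i),
    Sieve.le_generate (Presieve.ofArrows c _) _ _ (Presieve.ofArrows.mk i)⟩

instance canonicalTopology_subcanonical : (canonicalTopology A).Subcanonical := by
  refine GrothendieckTopology.Subcanonical.of_isSheaf_yoneda_obj _ fun d a S hS x hx => ?_
  have hS' : sSup {b | ∃ f : b ⟶ a, S f} = a := hS
  refine ⟨homOfLE (hS'.ge.trans (sSup_le fun b ⟨f, hf⟩ => (x f hf).le)), ?_, ?_⟩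
  · intro b _ _
    exact Subsingleton.elim (α := b ⟶ d) _ _
  · intro _ _
    exact Subsingleton.elim (α := a ⟶ d) _ _

/-- The subterminal sheaf `{d ≤ a}` attached to an element `a` of the Heyting algebra. -/
abbrev sub (a : A) : Sh A := (canonicalTopology A).yoneda.obj a

/-- The inclusion of subterminal sheaves attached to an inequality. -/
abbrev subMap {a b : A} (h : a ≤ b) : sub a ⟶ sub b := (canonicalTopology A).yoneda.map (homOfLE h)

theorem subMap_refl (a : A) : subMap (le_refl a) = 𝟙 (sub a) :=
  (canonicalTopology A).yoneda.map_id a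

theorem subMap_comp {a b c : A} (h : a ≤ b) (h' : b ≤ c) :
    subMap h ≫ subMap h' = subMap (h.trans h') :=
  ((canonicalTopology A).yoneda.map_comp _ _).symm

/-- A map out of `sub (⨆ i, c i)` is determined by its restrictions to the `sub (c i)`. -/
theorem sub_iSup_hom_ext {S : Sh A} {ι : Type*} (c : ι → A) {f g : sub (⨆ i, c i) ⟶ S}
    (h : ∀ i, subMap (le_iSup c i) ≫ f = subMap (le_iSup c i) ≫ g) : f = g := by
  apply (canonicalTopology A).yonedaEquiv.injective
  refine (iSup_isSheafFor S c).isSeparatedFor.ext ?_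
  rintro _ _ ⟨i⟩
  rw [GrothendieckTopology.yonedaEquiv_naturality, GrothendieckTopology.yonedaEquiv_naturality]
  exact congrArg _ (h i)

/-- Compatible maps out of a chain of subterminal sheaves glue. -/
theorem exists_sub_iSup_desc {S : Sh A} {J : Type*} [LinearOrder J] (c : J → A) (hc : Monotone c)
    (f : ∀ j, sub (c j) ⟶ S) (hf : ∀ i j (h : i ≤ j), subMap (hc h) ≫ f j = f i) :
    ∃ g : sub (⨆ j, c j) ⟶ S, ∀ j, subMap (le_iSup c j) ≫ g = f j := by
  obtain ⟨t, ht, -⟩ := (Presieve.isSheafFor_arrows_iff _ _).1 (iSup_isSheafFor S c)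
    (fun j => (canonicalTopology A).yonedaEquiv (f j)) (by
      have key : ∀ i j (_ : i ≤ j) (Z : A) (gi : Z ⟶ c i) (gj : Z ⟶ c j),
          S.obj.map gi.op ((canonicalTopology A).yonedaEquiv (f i)) =
            S.obj.map gj.op ((canonicalTopology A).yonedaEquiv (f j)) := by
        intro i j h Z gi gj
        rw [GrothendieckTopology.yonedaEquiv_naturality,
          GrothendieckTopology.yonedaEquiv_naturality, ← hf i j h]
        exact congrArg _ ((reassoc_of% (subMap_comp gi.le (hc h))) (f j))
      intro i j Z gi gj _
      rcases le_total i j with h | h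
      · exact key i j h Z gi gj
      · exact (key j i h Z gj gi).symm)
  refine ⟨(canonicalTopology A).yonedaEquiv.symm t, fun j => ?_⟩
  rw [GrothendieckTopology.yonedaEquiv_symm_naturality_left, ht j, Equiv.symm_apply_apply]

/-- A subterminal sheaf has a section over the join of all elements over which it has a section. -/
theorem nonempty_sub_sSup_hom {T : Sh A} (hT : ∀ S : Sh A, Subsingleton (S ⟶ T)) :
    Nonempty (sub (sSup {d : A | Nonempty (sub d ⟶ T)}) ⟶ T) := by
  rw [sSup_eq_iSup']
  set s := {d : A | Nonempty (sub d ⟶ T)}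
  -- The arbitrary local choices `d.2.some` agree on overlaps because `T` is subterminal.
  obtain ⟨t, -, -⟩ := (Presieve.isSheafFor_arrows_iff _ _).1
    (iSup_isSheafFor T fun d : s => (d : A))
    (fun d => (canonicalTopology A).yonedaEquiv d.2.some) (by
      intro i j Z gi gj _
      rw [GrothendieckTopology.yonedaEquiv_naturality, GrothendieckTopology.yonedaEquiv_naturality]
      exact congrArg _ ((hT _).elim _ _))
  exact ⟨(canonicalTopology A).yonedaEquiv.symm t⟩

/-! ### The functor `▶` on subterminal sheaves, and Löb induction -/

instance later_preservesFiniteLimits (K : Set A) : PreservesFiniteLimits (later K) := by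
  unfold later
  infer_instance

theorem subsingleton_hom_sub (S : Sh A) (a : A) : Subsingleton (S ⟶ sub a) := by
  refine ⟨fun f g => ?_⟩
  apply ObjectProperty.hom_ext
  ext d x
  exact Subsingleton.elim (α := (unop d ⟶ a)) _ _

/-- Being left exact, `▶` preserves both the terminal object and monomorphisms into it. -/
theorem subsingleton_hom_later (K : Set A) {T : Sh A} (hT : ∀ S : Sh A, Subsingleton (S ⟶ T))
    (S : Sh A) : Subsingleton (S ⟶ (later K).obj T) := by
  have : Mono (terminal.from T) := ⟨fun f g _ => (hT _).elim f g⟩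
  have ht : IsTerminal ((later K).obj (⊤_ (Sh A))) :=
    IsTerminal.isTerminalObj (later K) _ terminalIsTerminal
  exact ⟨fun f g => (cancel_mono ((later K).map (terminal.from T))).1 (ht.hom_ext _ _)⟩

/-- The largest element of the Heyting algebra over which `▶ (sub c)` has a section. -/
noncomputable def laterLevel (K : Set A) (c : A) : A :=
  sSup {d : A | Nonempty (sub d ⟶ (later K).obj (sub c))}

/-- The inclusion of `sub (laterLevel K c)` in `▶ (sub c)`. -/
noncomputable def subLaterLevel (K : Set A) (c : A) :
    sub (laterLevel K c) ⟶ (later K).obj (sub c) :=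
  (nonempty_sub_sSup_hom (subsingleton_hom_later K fun S => subsingleton_hom_sub S c)).some

theorem le_laterLevel (K : Set A) (c : A) : c ≤ laterLevel K c :=
  le_sSup ⟨(next K).app (sub c)⟩

/-- A section of `p^* (sub c)` over `d` is exactly a proof of `pred K d ≤ c`; the unit of
sheafification carries it to `▶ (sub c)`. -/
theorem le_laterLevel_of_pred_le (K : Set A) {c d : A} (h : pred K d ≤ c) : d ≤ laterLevel K c := by
  refine le_sSup ⟨(canonicalTopology A).yonedaEquiv.symm ?_⟩
  exact (toSheafify (canonicalTopology A) ((predPullback K).obj (sub c).obj)).app (op d)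
    (homOfLE h : pred K d ⟶ c)

/-- Löb induction. -/
theorem eq_top_of_laterLevel_le {K : Set A} (hK : IsWellFoundedBasis K) {c : A}
    (h : laterLevel K c ≤ c) : c = ⊤ := by
  have hwf : WellFounded fun a b : K => (a : A) < b := by
    rw [wellFounded_iff_isEmpty_descending_chain]
    exact ⟨fun s => hK.wellFounded ⟨fun n => (s.1 n : A), fun n => (s.1 n).2, s.2⟩⟩
  have hle : ∀ k : K, (k : A) ≤ c := fun k => by
    induction k using hwf.induction with
    | _ k ih =>
      -- The induction hypothesis bounds every basis element strictly below `k`, hence their join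
      -- `pred K k`.
      exact (le_laterLevel_of_pred_le K (sSup_le fun d hd => ih ⟨d, hd.1⟩ hd.2)).trans h
  exact top_le_iff.1 ((hK.isLUB ⊤).2 fun k hk => hle ⟨k, hk.1⟩)

/-! ### Limits of algebras for an endofunctor -/

section AlgebraLimits

variable {D : Type u} [Category.{v} D] {F : D ⥤ D} {J : Type v} [SmallCategory J]

section

variable (P : J ⥤ Endofunctor.Algebra F) [HasLimit (P ⋙ Endofunctor.Algebra.forget F)]

/-- The projections from the limit of the diagram of objects underlying a diagram of algebras. -/
noncomputable def algebraLimitProj (j : J) :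
    limit (P ⋙ Endofunctor.Algebra.forget F) ⟶ (P.obj j).a :=
  limit.π (P ⋙ Endofunctor.Algebra.forget F) j

theorem algebraLimitProj_w {i j : J} (f : i ⟶ j) :
    algebraLimitProj P i ≫ (P.map f).f = algebraLimitProj P j :=
  limit.w (P ⋙ Endofunctor.Algebra.forget F) f

variable {P} in
theorem algebraLimit_hom_ext {X : D} {f g : X ⟶ limit (P ⋙ Endofunctor.Algebra.forget F)}
    (h : ∀ j, f ≫ algebraLimitProj P j = g ≫ algebraLimitProj P j) : f = g :=
  limit.hom_ext h

theorem exists_algebraLimit_lift {X : D} (p : ∀ j, X ⟶ (P.obj j).a)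
    (hp : ∀ i j (f : i ⟶ j), p i ≫ (P.map f).f = p j) :
    ∃ g : X ⟶ limit (P ⋙ Endofunctor.Algebra.forget F), ∀ j, g ≫ algebraLimitProj P j = p j :=
  ⟨limit.lift (P ⋙ Endofunctor.Algebra.forget F)
    ⟨X, ⟨p, fun i j f => (Category.id_comp _).trans (hp i j f).symm⟩⟩, fun _ => limit.lift_π _ _⟩

theorem exists_algebraLimit_str :
    ∃ g : F.obj (limit (P ⋙ Endofunctor.Algebra.forget F)) ⟶
        limit (P ⋙ Endofunctor.Algebra.forget F),
      ∀ j, g ≫ algebraLimitProj P j = F.map (algebraLimitProj P j) ≫ (P.obj j).str :=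
  exists_algebraLimit_lift P _ fun i j f => by
    rw [Category.assoc, ← (P.map f).h, ← F.map_comp_assoc, algebraLimitProj_w]

/-- The cone over a diagram of algebras, whose vertex is the limit of the underlying diagram. -/
noncomputable def algebraLimitCone : Cone P where
  pt := ⟨limit (P ⋙ Endofunctor.Algebra.forget F), (exists_algebraLimit_str P).choose⟩
  π :=
    { app := fun j => ⟨algebraLimitProj P j, ((exists_algebraLimit_str P).choose_spec j).symm⟩
      naturality := fun _ _ f => Endofunctor.Algebra.Hom.ext
        ((Category.id_comp _).trans (algebraLimitProj_w P f).symm) }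

theorem exists_algebraLimitCone_lift (s : Cone P) :
    ∃ g : s.pt ⟶ (algebraLimitCone P).pt, ∀ j, g.f ≫ algebraLimitProj P j = (s.π.app j).f := by
  obtain ⟨g, hg⟩ := exists_algebraLimit_lift P (X := s.pt.a) (fun j => (s.π.app j).f)
    fun i j f => congrArg Endofunctor.Algebra.Hom.f (s.w f)
  refine ⟨⟨g, algebraLimit_hom_ext fun j => ?_⟩, hg⟩
  have h := (s.π.app j).h
  calc (F.map g ≫ (exists_algebraLimit_str P).choose) ≫ algebraLimitProj P j
      = F.map (g ≫ algebraLimitProj P j) ≫ (P.obj j).str := by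
        rw [Category.assoc, (exists_algebraLimit_str P).choose_spec j, F.map_comp, Category.assoc]
    _ = s.pt.str ≫ g ≫ algebraLimitProj P j := by rw [hg]; exact h
    _ = _ := (Category.assoc _ _ _).symm

/-- The limit of the underlying diagram is the limit of a diagram of algebras. -/
noncomputable def algebraLimitConeIsLimit : IsLimit (algebraLimitCone P) where
  lift s := (exists_algebraLimitCone_lift P s).choose
  fac s j := Endofunctor.Algebra.Hom.ext ((exists_algebraLimitCone_lift P s).choose_spec j)
  uniq s _ hm := Endofunctor.Algebra.Hom.ext <| algebraLimit_hom_ext fun j =>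
    (congrArg Endofunctor.Algebra.Hom.f (hm j)).trans
      ((exists_algebraLimitCone_lift P s).choose_spec j).symm

end

instance algebra_hasLimitsOfShape [HasLimitsOfShape J D] :
    HasLimitsOfShape J (Endofunctor.Algebra F) :=
  ⟨fun P => ⟨⟨⟨_, algebraLimitConeIsLimit P⟩⟩⟩⟩

end AlgebraLimits

/-! ### Guarded actions and partially initial algebras -/

theorem next_naturality (K : Set A) {S T : Sh A} (f : S ⟶ T) :
    f ≫ (next K).app T = (next K).app S ≫ (later K).map f :=
  (next K).naturality f

/-- A category `D` with hom-sheaves, bifunctorial in its objects, whose global sections are the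
morphisms of `D`, and an endofunctor of `D` acting on hom-sheaves through `▶`. -/
structure GuardedAction (K : Set A) (D : Type u) [Category.{v} D] where
  /-- The sheaf of morphisms. -/
  hom : Dᵒᵖ ⥤ D ⥤ Sh A
  /-- Morphisms are global sections of the sheaf of morphisms. -/
  homEquiv (X Y : D) : (X ⟶ Y) ≃ (𝟙_ (Sh A) ⟶ (hom.obj (op X)).obj Y)
  homEquiv_comp_right {X Y Z : D} (f : X ⟶ Y) (g : Y ⟶ Z) :
    homEquiv X Z (f ≫ g) = homEquiv X Y f ≫ (hom.obj (op X)).map g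
  homEquiv_comp_left {X Y Z : D} (f : X ⟶ Y) (g : Y ⟶ Z) :
    homEquiv X Z (f ≫ g) = homEquiv Y Z g ≫ (hom.map f.op).app Z
  /-- The endofunctor. -/
  functor : D ⥤ D
  /-- The action of the endofunctor on delayed morphisms. -/
  act (X Y : D) : (later K).obj ((hom.obj (op X)).obj Y) ⟶
    (hom.obj (op (functor.obj X))).obj (functor.obj Y)
  act_left {X X' : D} (f : X' ⟶ X) (Y : D) :
    (later K).map ((hom.map f.op).app Y) ≫ act X' Y =
      act X Y ≫ (hom.map (functor.map f).op).app (functor.obj Y)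
  homEquiv_map {X Y : D} (f : X ⟶ Y) :
    homEquiv _ _ (functor.map f) = homEquiv X Y f ≫ (next K).app _ ≫ act X Y

namespace GuardedAction

variable {K : Set A} {D : Type u} [Category.{v} D] (Φ : GuardedAction K D)

/-- The algebras of the underlying endofunctor. -/
abbrev Alg := Endofunctor.Algebra Φ.functor

/-- The sheaf of morphisms. -/
abbrev Hom (X Y : D) : Sh A := (Φ.hom.obj (op X)).obj Y

/-- Precomposition on the sheaves of morphisms. -/
abbrev pre {X' X : D} (f : X' ⟶ X) (Y : D) : Φ.Hom X Y ⟶ Φ.Hom X' Y := (Φ.hom.map f.op).app Y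

/-- Postcomposition on the sheaves of morphisms. -/
abbrev post (X : D) {Y Y' : D} (g : Y ⟶ Y') : Φ.Hom X Y ⟶ Φ.Hom X Y' := (Φ.hom.obj (op X)).map g

theorem pre_id (X Y : D) : Φ.pre (𝟙 X) Y = 𝟙 _ := by
  simp [pre]

theorem pre_comp {X X' X'' : D} (f : X'' ⟶ X') (g : X' ⟶ X) (Y : D) :
    Φ.pre (f ≫ g) Y = Φ.pre g Y ≫ Φ.pre f Y := by
  simp [pre]

theorem pre_post {X' X : D} (f : X' ⟶ X) {Y Y' : D} (g : Y ⟶ Y') :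
    Φ.pre f Y ≫ Φ.post X' g = Φ.post X g ≫ Φ.pre f Y' :=
  ((Φ.hom.map f.op).naturality g).symm

theorem pre_act {X' X : D} (f : X' ⟶ X) (Y : D) : (later K).map (Φ.pre f Y) ≫ Φ.act X' Y =
    Φ.act X Y ≫ Φ.pre (Φ.functor.map f) (Φ.functor.obj Y) :=
  Φ.act_left f Y

/-- An algebra together with a partial morphism, defined at the stage `level`, to each algebra. -/
structure PartialInitial where
  /-- The underlying algebra. -/
  alg : Φ.Alg
  /-- The stage at which the partial morphisms are defined. -/
  level : A
  /-- The partial morphisms. -/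
  desc (Y : Φ.Alg) : sub level ⟶ Φ.Hom alg.a Y.a
  -- The algebra morphism equation at stage `level`: `next` followed by `act` plays the role of
  -- applying the endofunctor to `desc Y`.
  desc_str (Y : Φ.Alg) : desc Y ≫ Φ.pre alg.str Y.a =
    desc Y ≫ (next K).app _ ≫ Φ.act _ _ ≫ Φ.post _ Y.str

namespace PartialInitial

variable {Φ}

/-- A morphism of partially initial algebras is a morphism of algebras, in the opposite direction,
which is compatible with the partial morphisms. -/
@[ext]
structure Hom (P Q : Φ.PartialInitial) where
  /-- The underlying morphism of algebras. -/
  hom : Q.alg ⟶ P.alg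
  le : P.level ≤ Q.level
  comm (Y : Φ.Alg) : subMap le ≫ Q.desc Y = P.desc Y ≫ Φ.pre hom.f Y.a

instance : Category Φ.PartialInitial where
  Hom := Hom
  id P := ⟨𝟙 _, le_rfl, fun Y => by
    rw [subMap_refl, Category.id_comp, Endofunctor.Algebra.id_f, pre_id, Category.comp_id]⟩
  comp f g := ⟨g.hom ≫ f.hom, f.le.trans g.le, fun Y => by
    rw [← subMap_comp f.le g.le, Category.assoc, g.comm, ← Category.assoc, f.comm, Category.assoc,
      Endofunctor.Algebra.comp_f, pre_comp]⟩

theorem level_le {P Q : Φ.PartialInitial} (f : P ⟶ Q) : P.level ≤ Q.level := Hom.le f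

/-! ### Colimits of chains of partially initial algebras -/

section Colimits

variable {J : Type v} [LinearOrder J] (P : J ⥤ Φ.PartialInitial)

/-- The diagram of algebras underlying a diagram of partially initial algebras. -/
def algDiagram : Jᵒᵖ ⥤ Φ.Alg where
  obj j := (P.obj j.unop).alg
  map f := (P.map f.unop).hom
  map_id j := congrArg Hom.hom (P.map_id j.unop)
  map_comp f g := congrArg Hom.hom (P.map_comp g.unop f.unop)

/-- The levels of a diagram of partially initial algebras. -/
abbrev levels (j : J) : A := (P.obj j).level

theorem levels_mono : Monotone (levels P) := fun _ _ h => level_le (P.map (homOfLE h))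

variable [HasLimitsOfSize.{v, v} D]

/-- The projections from the limit of the diagram of algebras underlying a diagram of partially
initial algebras. -/
noncomputable def algProj (j : J) : limit (algDiagram P) ⟶ (P.obj j).alg :=
  limit.π (algDiagram P) (op j)

theorem algProj_w {i j : J} (f : i ⟶ j) : algProj P j ≫ (P.map f).hom = algProj P i :=
  limit.w (algDiagram P) f.op

variable {P} in
theorem algProj_hom_ext {X : Φ.Alg} {f g : X ⟶ limit (algDiagram P)}
    (h : ∀ j, f ≫ algProj P j = g ≫ algProj P j) : f = g :=
  limit.hom_ext fun j => h j.unop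

theorem exists_algProj_lift (s : Cocone P) :
    ∃ g : s.pt.alg ⟶ limit (algDiagram P), ∀ j, g ≫ algProj P j = (s.ι.app j).hom :=
  ⟨limit.lift (algDiagram P)
    ⟨s.pt.alg, ⟨fun j => (s.ι.app j.unop).hom, fun _ _ f =>
      (Category.id_comp _).trans (congrArg Hom.hom (s.w f.unop)).symm⟩⟩,
    fun j => limit.lift_π _ (op j)⟩

/-- The family glues because the transition maps of the chain commute with the partial morphisms
(`comm`). -/
theorem exists_desc (Y : Φ.Alg) :
    ∃ g : sub (⨆ j, levels P j) ⟶ Φ.Hom (limit (algDiagram P)).a Y.a,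
      ∀ j, subMap (le_iSup (levels P) j) ≫ g = (P.obj j).desc Y ≫ Φ.pre (algProj P j).f Y.a := by
  refine exists_sub_iSup_desc (levels P) (levels_mono P) _ fun i j h => ?_
  have h₁ := (P.map (homOfLE h)).comm Y
  rw [← algProj_w P (homOfLE h), Endofunctor.Algebra.comp_f, pre_comp, ← Category.assoc,
    ← Category.assoc, ← h₁]

/-- The partial morphisms out of the colimit of a chain of partially initial algebras. -/
noncomputable def chainDesc (Y : Φ.Alg) :
    sub (⨆ j, levels P j) ⟶ Φ.Hom (limit (algDiagram P)).a Y.a :=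
  (exists_desc P Y).choose

theorem subMap_chainDesc (Y : Φ.Alg) (j : J) : subMap (le_iSup (levels P) j) ≫ chainDesc P Y =
    (P.obj j).desc Y ≫ Φ.pre (algProj P j).f Y.a :=
  (exists_desc P Y).choose_spec j

/-- The colimit of a chain of partially initial algebras. -/
noncomputable def chainColimit : Φ.PartialInitial where
  alg := limit (algDiagram P)
  level := ⨆ j, levels P j
  desc Y := chainDesc P Y
  desc_str Y := by
    refine sub_iSup_hom_ext _ fun j => ?_
    rw [reassoc_of% (subMap_chainDesc P Y j), reassoc_of% (subMap_chainDesc P Y j), ← pre_comp, ← (algProj P j).h, pre_comp,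
      reassoc_of% ((P.obj j).desc_str Y), reassoc_of% (next_naturality K (Φ.pre (algProj P j).f Y.a)),
      reassoc_of% (Φ.pre_act (algProj P j).f Y.a), pre_post]

/-- The colimit cocone of a chain of partially initial algebras. -/
noncomputable def chainCocone : Cocone P where
  pt := chainColimit P
  ι :=
    { app := fun j => ⟨algProj P j, le_iSup (levels P) j, fun Y => subMap_chainDesc P Y j⟩
      naturality := fun _ _ f => Hom.ext ((algProj_w P f).trans (Category.id_comp _).symm) }

theorem exists_chainColimit_desc (s : Cocone P) :
    ∃ g : chainColimit P ⟶ s.pt, ∀ j, g.hom ≫ algProj P j = (s.ι.app j).hom := by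
  obtain ⟨g, hg⟩ := exists_algProj_lift P s
  have hle : ⨆ j, levels P j ≤ s.pt.level := iSup_le fun j => level_le (s.ι.app j)
  refine ⟨⟨g, hle, fun Y => sub_iSup_hom_ext (levels P) fun j => ?_⟩, hg⟩
  have h : subMap (level_le (s.ι.app j)) ≫ s.pt.desc Y =
    (P.obj j).desc Y ≫ Φ.pre (s.ι.app j).hom.f Y.a := (s.ι.app j).comm Y
  have h' := (reassoc_of% (subMap_chainDesc P Y j)) (Φ.pre g.f Y.a)
  refine ((reassoc_of% (subMap_comp (le_iSup (levels P) j) hle)) _).trans (h.trans (Eq.trans ?_ h'.symm))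
  rw [← hg j, Endofunctor.Algebra.comp_f, pre_comp]

/-- `chainCocone` is a colimit cocone. -/
noncomputable def chainCoconeIsColimit : IsColimit (chainCocone P) where
  desc s := (exists_chainColimit_desc P s).choose
  fac s j := Hom.ext ((exists_chainColimit_desc P s).choose_spec j)
  uniq s _ hm := Hom.ext <| algProj_hom_ext fun j =>
    (congrArg Hom.hom (hm j)).trans ((exists_chainColimit_desc P s).choose_spec j).symm

instance : HasColimitsOfShape J Φ.PartialInitial :=
  ⟨fun P => ⟨⟨⟨_, chainCoconeIsColimit P⟩⟩⟩⟩

end Colimits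

/-! ### Successor step and transfinite iteration -/

/-- The action of the endofunctor on partially initial algebras. -/
noncomputable def succ (P : Φ.PartialInitial) : Φ.PartialInitial where
  alg := ⟨Φ.functor.obj P.alg.a, Φ.functor.map P.alg.str⟩
  level := laterLevel K P.level
  desc Y := subLaterLevel K P.level ≫ (later K).map (P.desc Y) ≫ Φ.act _ _ ≫ Φ.post _ Y.str
  desc_str Y := by
    -- The two maps agree because their target `▶ ▶ (sub c)` is subterminal.
    have hs : (next K).app ((later K).obj (sub P.level)) =
        (later K).map ((next K).app (sub P.level)) :=
      (subsingleton_hom_later K (subsingleton_hom_later K fun S => subsingleton_hom_sub S _)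
        _).elim _ _
    have hP := congrArg (later K).map
      ((P.desc_str Y).trans ((reassoc_of% (next_naturality K (P.desc Y))) _))
    simp only [Functor.map_comp] at hP
    simp only [Category.assoc]
    rw [← pre_post, ← reassoc_of% (Φ.pre_act P.alg.str Y.a), reassoc_of% hP, ← hs,
      reassoc_of% (next_naturality K (Φ.post _ Y.str)), reassoc_of% (next_naturality K (Φ.act _ _)),
      reassoc_of% (next_naturality K ((later K).map (P.desc Y)))]

/-- The structure morphism of a partially initial algebra, as a morphism of partially initial
algebras. -/
noncomputable def toSucc (P : Φ.PartialInitial) : P ⟶ P.succ where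
  hom := ⟨P.alg.str, rfl⟩
  le := le_laterLevel K P.level
  comm Y := by
    have h : subMap (le_laterLevel K P.level) ≫ subLaterLevel K P.level =
        (next K).app (sub P.level) :=
      (subsingleton_hom_later K (fun S => subsingleton_hom_sub S _) _).elim _ _
    change subMap _ ≫ subLaterLevel K P.level ≫ _ = P.desc Y ≫ Φ.pre P.alg.str Y.a
    rw [reassoc_of% h, P.desc_str, reassoc_of% (next_naturality K (P.desc Y))]

variable [HasLimitsOfSize.{v, v} D]

variable (Φ) in
/-- The successor structure given by the action of the endofunctor, starting from the initial object. -/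
noncomputable def succStruct : SmallObject.SuccStruct Φ.PartialInitial where
  -- `PEmpty` is a linear order, so the initial object is the colimit of the empty chain.
  X₀ := colimit (C := Φ.PartialInitial) (J := PEmpty.{v + 1})
    { obj := PEmpty.elim
      map := @fun X _ _ => X.elim
      map_id := fun X => X.elim
      map_comp := @fun X _ _ _ _ => X.elim }
  succ := succ
  toSucc := toSucc

variable (Φ) in
theorem exists_level_eq_top (hK : IsWellFoundedBasis K) : ∃ P : Φ.PartialInitial, P.level = ⊤ := by
  by_contra! hP
  -- The index order has more elements than `A`, so no strictly monotone map to `A` exists.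
  let κ := Order.succ (Cardinal.mk A)
  let J := κ.ord.ToType
  have hJ : Nonempty J := by
    rw [← Cardinal.mk_ne_zero_iff, Cardinal.mk_ord_toType]
    exact (Order.bot_lt_succ (Cardinal.mk A)).ne'
  let : OrderBot J := WellFoundedLT.toOrderBot J
  let : SuccOrder J := SuccOrder.ofLinearWellFoundedLT J
  have : HasIterationOfShape J Φ.PartialInitial := {}
  let S := (succStruct Φ).iterationFunctor J
  have hS : StrictMono fun j => (S.obj j).level := fun i j h => by
    have hi : ¬ IsMax i := fun hi => hi.not_lt h
    refine lt_of_lt_of_le ?_ (level_le (S.map (homOfLE (Order.succ_le_of_lt h))))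
    refine lt_of_lt_of_le ?_ (level_le ((succStruct Φ).iterationFunctorObjSuccIso i hi).inv)
    exact lt_of_le_not_ge (le_laterLevel K _) fun h => hP _ (eq_top_of_laterLevel_le hK h)
  have h₁ := Cardinal.mk_le_of_injective hS.injective
  rw [Cardinal.mk_ord_toType] at h₁
  exact (Order.lt_succ (Cardinal.mk A)).not_ge h₁

end PartialInitial

/-! ### From weak initiality to a fixed point -/

variable [HasLimitsOfSize.{v, v} D]

/-- At level `⊤` each `desc Y` gives a global section, hence a morphism, and `desc_str` becomes the
algebra equation. -/
theorem exists_weakly_initial (hK : IsWellFoundedBasis K) :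
    ∃ X : Φ.Alg, ∀ Y : Φ.Alg, Nonempty (X ⟶ Y) := by
  obtain ⟨⟨X, c, desc, desc_str⟩, rfl : c = ⊤⟩ := PartialInitial.exists_level_eq_top Φ hK
  refine ⟨X, fun Y => ?_⟩
  let t : 𝟙_ (Sh A) ⟶ sub (⊤ : A) :=
    ⟨{ app := fun d => ↾fun _ => (homOfLE le_top : d.unop ⟶ ⊤)
       naturality := fun _ _ _ => rfl }⟩
  have ht : t ≫ desc Y = Φ.homEquiv X.a Y.a ((Φ.homEquiv X.a Y.a).symm (t ≫ desc Y)) :=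
    (Equiv.apply_symm_apply _ _).symm
  refine ⟨⟨(Φ.homEquiv X.a Y.a).symm (t ≫ desc Y), (Φ.homEquiv _ _).injective ?_⟩⟩
  rw [homEquiv_comp_right, homEquiv_comp_left, homEquiv_map, ← ht]
  have := congrArg (t ≫ ·) (desc_str Y)
  simpa using this.symm

/-- The underlying endofunctor has a fixed point. -/
theorem exists_fixed_point (hK : IsWellFoundedBasis K) :
    ∃ X : D, Nonempty (Φ.functor.obj X ≅ X) := by
  obtain ⟨X, hX⟩ := Φ.exists_weakly_initial hK
  -- Equalizing all endomorphisms of the weakly initial algebra makes it initial.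
  have : HasWideEqualizers.{v} Φ.Alg := fun J => inferInstance
  have := hasInitial_of_weakly_initial_and_hasWideEqualizers hX
  have := Endofunctor.Algebra.Initial.str_isIso (initialIsInitial (C := Φ.Alg))
  exact ⟨_, ⟨asIso (⊥_ Φ.Alg).str⟩⟩

end GuardedAction
-- Guarded actions from enriched functors
theorem next_unit (K : Set A) :
    (next K).app (𝟙_ (Sh A)) = Functor.LaxMonoidal.ε (later K) := by
  rw [← cancel_mono (Functor.Monoidal.εIso (later K)).inv]
  exact toUnit_unique _ _

/-- Whiskering by a delayed global section is delayed whiskering. -/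
theorem leftUnitor_inv_next_whiskerRight (K : Set A) {S T : Sh A} (f : 𝟙_ (Sh A) ⟶ S) :
    (λ_ ((later K).obj T)).inv ≫ (f ≫ (next K).app S) ▷ (later K).obj T ≫
      Functor.LaxMonoidal.μ (later K) S T = (later K).map ((λ_ T).inv ≫ f ▷ T) := by
  rw [next_naturality, next_unit, comp_whiskerRight, Category.assoc,
    Functor.LaxMonoidal.μ_natural_left, Functor.LaxMonoidal.left_unitality_inv_assoc,
    Functor.map_comp]

/-- A delayed composition operation, applied to a global section in its first argument. -/
theorem later_map_section_comp (K : Set A) {P Q R P' Q' R' : Sh A} {e : P ⊗ Q ⟶ R}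
    {e' : P' ⊗ Q' ⟶ R'} {p : (later K).obj P ⟶ P'} {q : (later K).obj Q ⟶ Q'}
    {r : (later K).obj R ⟶ R'}
    (h : (Functor.LaxMonoidal.μ (later K) P Q ≫ (later K).map e) ≫ r = (p ⊗ₘ q) ≫ e')
    (f : 𝟙_ (Sh A) ⟶ P) :
    (later K).map ((λ_ Q).inv ≫ f ▷ Q ≫ e) ≫ r =
      q ≫ (λ_ Q').inv ≫ (f ≫ (next K).app P ≫ p) ▷ Q' ≫ e' := by
  calc _ = (later K).map ((λ_ Q).inv ≫ f ▷ Q) ≫ (later K).map e ≫ r := by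
        simp only [Functor.map_comp, Category.assoc]
    _ = (λ_ _).inv ≫ (f ≫ (next K).app P) ▷ _ ≫ (p ⊗ₘ q) ≫ e' := by
        rw [← leftUnitor_inv_next_whiskerRight, ← h]
        simp only [Category.assoc]
    _ = _ := by
        rw [leftUnitor_inv_naturality_assoc, tensorHom_def_assoc, whisker_exchange_assoc,
          ← comp_whiskerRight_assoc, Category.assoc]

section

variable {V : Type*} [Category* V] [MonoidalCategory V] {D : Type*} [Category* D]
  [EnrichedOrdinaryCategory V D] {X Y Z : D}

theorem eHomEquiv_comp_eHomWhiskerLeft (f : X ⟶ Y) (g : Y ⟶ Z) :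
    eHomEquiv V (f ≫ g) = eHomEquiv V f ≫ eHomWhiskerLeft V X g := by
  rw [eHomEquiv_comp]
  simp [eHomWhiskerLeft, MonoidalCategory.tensorHom_def, unitors_inv_equal]

theorem eHomEquiv_comp_eHomWhiskerRight (f : X ⟶ Y) (g : Y ⟶ Z) :
    eHomEquiv V (f ≫ g) = eHomEquiv V g ≫ eHomWhiskerRight V f Z := by
  rw [eHomEquiv_comp]
  simp [eHomWhiskerRight, tensorHom_def']

end

variable {K : Set A} {C : Type u} [EnrichedCategory (Sh A) C]

/-- The externalisation of a locally contractive functor, with its action on hom-sheaves. -/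
noncomputable def contractiveAction (G : EnrichedFunctor (Sh A) (LaterCat K C) C) :
    GuardedAction K (ForgetEnrichment (Sh A) C) where
  hom := eHomFunctor (Sh A) (ForgetEnrichment (Sh A) C)
  homEquiv _ _ := eHomEquiv (Sh A)
  homEquiv_comp_right f g := eHomEquiv_comp_eHomWhiskerLeft f g
  homEquiv_comp_left f g := eHomEquiv_comp_eHomWhiskerRight f g
  functor := ((nextFunctor K C).comp (Sh A) G).forget
  act X Y := G.map X Y
  -- Compatibility of `G` with composition, specialised to the global section `f` in the first
  -- argument.
  act_left {X X'} f Y := later_map_section_comp K (G.map_comp X' X Y) f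
  homEquiv_map _ := rfl

end GuardedRec

theorem mainTheorem2 {A : Type v} [Order.Frame A] (K : Set A)
    (hK : GuardedRec.IsWellFoundedBasis K)
    (C : Type u) [EnrichedCategory (GuardedRec.Sh A) C]
    (hC : HasLimitsOfSize.{v, v} (ForgetEnrichment (GuardedRec.Sh A) C)) :
    GuardedRec.ContractivelyComplete K C := by
  rintro _ ⟨G, rfl⟩
  exact (GuardedRec.contractiveAction G).exists_fixed_point hK
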